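/- Let $k$ be an uncountable algebraically closed field of characteristic $\neq 2$ and let $r \ge 0$ be an integer. All vector spaces are over $k$ and of dimension at most $\aleph_0$. An $r$-quadratic space is a vector space $V$ with symmetric bilinear forms $\omega_1, \ldots, \omega_r$ on $V$; an isomorphism $V \to V'$ of $r$-quadratic spaces is a linear isomorphism carrying $\omega_i'$ to $\omega_i$ for every $i$, and $\mathrm{Aut}(V)$ is the group of automorphisms of $V$. The space $V$ is irreducible if it is an irreducible representation of $\mathrm{Aut}(V)$ (so $V \neq 0$). Put $\Theta(V) = \{\alpha \in k^r : \sum_{i=1}^r \alpha_i \omega_i = 0\}$. The theory of $V$ is the set of all sentences true in $V$ in the following two-sorted first-order language: scalar variables range over $k$ and vector variables over $V$; there are a constant for each element of $k$, a vector constant $0$, addition and multiplication of scalars, addition of vectors, scalar multiplication, and function symbols $\omega_1, \ldots, \omega_r$ taking two vectors to a scalar; atomic formulas are equations between terms of the same sort. An $r$-quadratic space $V$ is linearly $\omega$-categorical if every $r$-quadratic space (of dimension at most $\aleph_0$) with the same theory as $V$ is isomorphic to $V$. A representation $V$ of a group $G$ is linearly oligomorphic if for every $d \ge 0$ there is a finite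 dimensional subspace $E \subset V$ such that every $d$-dimensional subspace $W \subset V$ satisfies $gW \subset E$ for some $g \in G$; a linearly oligomorphic group is a group with a faithful linearly oligomorphic representation. Then: (a) If $V$ and $V'$ are infinite dimensional irreducible $r$-quadratic spaces, then $V$ and $V'$ are isomorphic if and only if $\Theta(V) = \Theta(V')$. (b) Every infinite dimensional irreducible $r$-quadratic space is linearly $\omega$-categorical. (c) If $V$ is an irreducible $r$-quadratic space (of finite or infinite dimension), then $\mathrm{Aut}(V)$, acting on $V$, is linearly oligomorphic. -/

import Mathlib

universe u v w

/-- An `r`-quadratic structure on the `k`-vector space `V`: a tuple of `r` symmetric bilinear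
forms on `V`. -/
structure MultiQuadratic (k : Type u) [Field k] (r : ℕ) (V : Type v) [AddCommGroup V]
    [Module k V] where
  form : Fin r → LinearMap.BilinForm k V
  symm : ∀ i x y, form i x y = form i y x

namespace MultiQuadratic

section Basic

variable {k : Type u} [Field k] {r : ℕ}
  {V : Type v} [AddCommGroup V] [Module k V]
  {W : Type w} [AddCommGroup W] [Module k W]

/-- An isomorphism of `r`-quadratic spaces: a linear isomorphism that respects all the forms. -/
structure Iso (A : MultiQuadratic k r V) (B : MultiQuadratic k r W) extends V ≃ₗ[k] W where
  map_form : ∀ i x y, B.form i (toLinearEquiv x) (toLinearEquiv y) = A.form i x y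

/-- Two `r`-quadratic spaces are isomorphic. -/
def Isomorphic (A : MultiQuadratic k r V) (B : MultiQuadratic k r W) : Prop :=
  Nonempty (A.Iso B)

/-- The automorphism group of an `r`-quadratic space: all linear automorphisms that preserve
every form. -/
def aut (A : MultiQuadratic k r V) : Subgroup (V ≃ₗ[k] V) where
  carrier := {g | ∀ i x y, A.form i (g x) (g y) = A.form i x y}
  one_mem' := fun _ _ _ => rfl
  mul_mem' := by
    intro g h hg hh i x y
    exact (hg i (h x) (h y)).trans (hh i x y)
  inv_mem' := by
    intro g hg i x y
    have h := hg i (g⁻¹ x) (g⁻¹ y)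
    rw [← LinearEquiv.mul_apply, ← LinearEquiv.mul_apply, mul_inv_cancel] at h
    exact h.symm

/-- The tautological representation of the automorphism group on `V`. -/
def autRep (A : MultiQuadratic k r V) : Representation k A.aut V where
  toFun g := (g : V ≃ₗ[k] V).toLinearMap
  map_one' := rfl
  map_mul' _ _ := rfl

/-- An `r`-quadratic space is irreducible if it is an irreducible representation of its
automorphism group (in particular it is non-zero). -/
def IsIrreducible (A : MultiQuadratic k r V) : Prop :=
  A.autRep.IsIrreducible

/-- The space `Θ` of linear relations among the forms. -/
def relations (A : MultiQuadratic k r V) : Submodule k (Fin r → k) where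
  carrier := {α | ∑ i, α i • A.form i = 0}
  zero_mem' := by simp
  add_mem' := by
    intro α β hα hβ
    simp only [Set.mem_ofPred_eq] at hα hβ ⊢
    simp only [Pi.add_apply, add_smul, Finset.sum_add_distrib, hα, hβ, add_zero]
  smul_mem' := by
    intro c α hα
    simp only [Set.mem_ofPred_eq] at hα ⊢
    simp only [Pi.smul_apply, smul_eq_mul, mul_smul, ← Finset.smul_sum, hα, smul_zero]

end Basic

/-! The two-sorted first-order language of `r`-quadratic spaces over `k`. Terms and formulas are
well scoped: `m` and `n` are the numbers of available scalar and vector variables. -/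

mutual

/-- Terms of the scalar sort: variables, a constant for each element of `k`, sums, products, and
values of the `r` forms. -/
inductive ScalarTerm (k : Type u) (r m n : ℕ) : Type u
  | var : Fin m → ScalarTerm k r m n
  | const : k → ScalarTerm k r m n
  | add : ScalarTerm k r m n → ScalarTerm k r m n → ScalarTerm k r m n
  | mul : ScalarTerm k r m n → ScalarTerm k r m n → ScalarTerm k r m n
  | form : Fin r → VectorTerm k r m n → VectorTerm k r m n → ScalarTerm k r m n

/-- Terms of the vector sort: variables, zero, sums, and scalar multiples. -/
inductive VectorTerm (k : Type u) (r m n : ℕ) : Type u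
  | var : Fin n → VectorTerm k r m n
  | zero : VectorTerm k r m n
  | add : VectorTerm k r m n → VectorTerm k r m n → VectorTerm k r m n
  | smul : ScalarTerm k r m n → VectorTerm k r m n → VectorTerm k r m n

end

/-- First-order formulas with `m` free scalar variables and `n` free vector variables: equations
in both sorts, closed under (classically complete) propositional connectives and quantification
over both sorts. -/
inductive Formula (k : Type u) (r : ℕ) : ℕ → ℕ → Type u
  | eqScalar {m n : ℕ} : ScalarTerm k r m n → ScalarTerm k r m n → Formula k r m n
  | eqVector {m n : ℕ} : VectorTerm k r m n → VectorTerm k r m n → Formula k r m n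
  | falsum {m n : ℕ} : Formula k r m n
  | imp {m n : ℕ} : Formula k r m n → Formula k r m n → Formula k r m n
  | allScalar {m n : ℕ} : Formula k r (m + 1) n → Formula k r m n
  | allVector {m n : ℕ} : Formula k r m (n + 1) → Formula k r m n

/-- Sentences: formulas without free variables. -/
abbrev Sentence (k : Type u) (r : ℕ) : Type u := Formula k r 0 0

section Semantics

variable {k : Type u} [Field k] {r : ℕ} {V : Type v} [AddCommGroup V] [Module k V]

mutual

/-- The value of a scalar term under an assignment of the variables. (The lifts only put `k` and
`V` into a common universe, as the mutual recursion requires.) -/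
def ScalarTerm.evalLift (A : MultiQuadratic k r V) {m n : ℕ} (a : Fin m → k) (x : Fin n → V) :
    ScalarTerm k r m n → ULift.{v} k
  | .var i => ⟨a i⟩
  | .const c => ⟨c⟩
  | .add s t => ⟨(ScalarTerm.evalLift A a x s).down + (ScalarTerm.evalLift A a x t).down⟩
  | .mul s t => ⟨(ScalarTerm.evalLift A a x s).down * (ScalarTerm.evalLift A a x t).down⟩
  | .form i s t =>
    ⟨A.form i (VectorTerm.evalLift A a x s).down (VectorTerm.evalLift A a x t).down⟩

/-- The value of a vector term under an assignment of the variables. -/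
def VectorTerm.evalLift (A : MultiQuadratic k r V) {m n : ℕ} (a : Fin m → k) (x : Fin n → V) :
    VectorTerm k r m n → ULift.{u} V
  | .var i => ⟨x i⟩
  | .zero => ⟨0⟩
  | .add s t => ⟨(VectorTerm.evalLift A a x s).down + (VectorTerm.evalLift A a x t).down⟩
  | .smul s t => ⟨(ScalarTerm.evalLift A a x s).down • (VectorTerm.evalLift A a x t).down⟩

end

/-- The value in `k` of a scalar term. -/
def ScalarTerm.eval (A : MultiQuadratic k r V) {m n : ℕ} (a : Fin m → k) (x : Fin n → V)
    (t : ScalarTerm k r m n) : k :=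
  (t.evalLift A a x).down

/-- The value in `V` of a vector term. -/
def VectorTerm.eval (A : MultiQuadratic k r V) {m n : ℕ} (a : Fin m → k) (x : Fin n → V)
    (t : VectorTerm k r m n) : V :=
  (t.evalLift A a x).down

/-- Truth of a formula under an assignment; scalar variables range over `k`, vector variables
over `V`. -/
def Formula.Realize (A : MultiQuadratic k r V) :
    {m n : ℕ} → Formula k r m n → (Fin m → k) → (Fin n → V) → Prop
  | _, _, .eqScalar s t, a, x => s.eval A a x = t.eval A a x
  | _, _, .eqVector s t, a, x => s.eval A a x = t.eval A a x
  | _, _, .falsum, _, _ => False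
  | _, _, .imp φ ψ, a, x => φ.Realize A a x → ψ.Realize A a x
  | _, _, .allScalar φ, a, x => ∀ c : k, φ.Realize A (Fin.snoc a c) x
  | _, _, .allVector φ, a, x => ∀ y : V, φ.Realize A a (Fin.snoc x y)

/-- The theory of an `r`-quadratic space: all sentences that are true in it. -/
def theory (A : MultiQuadratic k r V) : Set (Sentence k r) :=
  {φ | φ.Realize A Fin.elim0 Fin.elim0}

/-- An `r`-quadratic space is linearly `ω`-categorical if it is isomorphic to every
`r`-quadratic space of countable dimension with the same theory. -/
def LinearlyOmegaCategorical (A : MultiQuadratic k r V) : Prop :=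
  ∀ (W : Type w) [AddCommGroup W] [Module k W] (B : MultiQuadratic k r W),
    Module.rank k W ≤ Cardinal.aleph0 → A.theory = B.theory → A.Isomorphic B

end Semantics

end MultiQuadratic

/-- A representation is linearly oligomorphic if for every `d` there is a finite dimensional
subspace `E` such that every `d`-dimensional subspace has a translate contained in `E`. -/
def Representation.LinearlyOligomorphic {k : Type u} [Field k] {G : Type v} [Group G]
    {V : Type w} [AddCommGroup V] [Module k V] (ρ : Representation k G V) : Prop :=
  ∀ d : ℕ, ∃ E : Submodule k V, FiniteDimensional k E ∧
    ∀ W : Submodule k V, FiniteDimensional k W → Module.finrank k W = d →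
      ∃ g : G, W.map (ρ g) ≤ E

-- Each form is an equivariant map from `V` to its dual. Over an uncountable algebraically closed
-- field, Schur's lemma holds in countable dimension (`exists_eq_smul_of_commute`), so `s` linearly
-- independent forms on an irreducible space induce an injective map from `V^s` to the dual
-- (`jointlyNondegenerate`). From then on irreducibility enters only through this joint
-- nondegeneracy.
--
-- In infinite dimension it gives an extension property (`exists_extension`): the products of a new
-- vector with given independent vectors and with itself can be prescribed. The former are linear
-- conditions; the latter are met by combining mutually orthogonal solutions with suitable weights.
-- Back and forth (`exists_linearEquiv`) then extends every finite dimensional partial isometry to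
-- an isometry, and the forms outside a chosen basis of forms follow through the relations in Θ.
-- This gives (a). Infinite dimension, Θ and joint nondegeneracy are all visible in the theory,
-- which gives (b). For (c), one finite dimensional subspace realises all Gram matrices of size `d`
-- (`exists_universal_subspace`), and an isometry from `W` onto a subspace of it extends to an
-- automorphism.

-- Schur's lemma in countable dimension

open Polynomial in
/-- An endomorphism of a nonzero space of countable dimension over an uncountable algebraically
closed field has a point in its spectrum. -/
theorem Module.End.spectrum_nonempty_of_rank_le_aleph0 {k : Type u} [Field k] [IsAlgClosed k]
    [Uncountable k] {V : Type v} [AddCommGroup V] [Module k V] [Nontrivial V]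
    (hV : Module.rank k V ≤ Cardinal.aleph0) (φ : Module.End k V) :
    (spectrum k φ).Nonempty := by
  classical
  rw [Set.nonempty_iff_ne_empty]
  intro hs
  -- If the spectrum is empty, spectral mapping makes every nonzero polynomial in `φ` invertible.
  -- The vectors `(φ - c)⁻¹ v`, for `c` in `k`, will then be an uncountable independent family.
  have hu (p : k[X]) (hp : p ≠ 0) : IsUnit (aeval φ p) := by
    rcases Nat.eq_zero_or_pos p.natDegree with h0 | h0
    · obtain ⟨c, rfl⟩ := natDegree_eq_zero.1 h0
      rw [aeval_C]
      exact (IsUnit.mk0 c (by simpa using hp)).map _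
    · have := spectrum.map_polynomial_aeval_of_degree_pos φ p (natDegree_pos_iff_degree_pos.1 h0)
      rw [hs, Set.image_empty] at this
      have h : (0 : k) ∉ spectrum k (aeval φ p) := by rw [this]; exact id
      rwa [spectrum.zero_mem_iff, not_not] at h
  obtain ⟨v, hv⟩ := exists_ne (0 : V)
  have hex (c : k) : ∃ u, aeval φ (X - C c) u = v := by
    obtain ⟨e, he⟩ := hu _ (X_sub_C_ne_zero c)
    refine ⟨(↑e⁻¹ : Module.End k V) v, ?_⟩
    rw [← he, ← Module.End.mul_apply, Units.mul_inv, Module.End.one_apply]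
  choose u hu' using hex
  have hli : LinearIndependent k u := by
    refine linearIndependent_iff'.2 fun s m hm i hi ↦ ?_
    -- The numerator of `∑ m i / (X - i)`. The relation forces `p(φ) v = 0`, hence `p = 0`, and
    -- evaluating at `i` isolates `m i`.
    let p : k[X] := ∑ i ∈ s, C (m i) * ∏ j ∈ s.erase i, (X - C j)
    have hp : aeval φ p v = 0 := by
      have h1 := congr(aeval φ (∏ j ∈ s, (X - C j)) $hm)
      rw [map_zero, map_sum] at h1
      rw [← h1]
      simp only [p, map_sum, LinearMap.sum_apply]
      refine Finset.sum_congr rfl fun i hi ↦ ?_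
      rw [← s.prod_erase_mul _ hi, map_smul, map_mul (aeval φ) (∏ j ∈ s.erase i, (X - C j)),
        Module.End.mul_apply, hu', map_mul, aeval_C, Module.End.mul_apply,
        Module.algebraMap_end_apply]
    have hp0 : p = 0 := by
      by_contra h
      obtain ⟨e, he⟩ := hu p h
      apply hv
      have := congr((↑e⁻¹ : Module.End k V) $hp)
      rwa [← he, ← Module.End.mul_apply, Units.inv_mul, Module.End.one_apply, map_zero] at this
    have h2 := congr(eval i $hp0)
    have h3 : ∀ j ∈ s.erase i, m j * ∏ x ∈ s.erase j, (i - x) = 0 := fun j hj ↦ by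
      have := Finset.mem_erase_of_ne_of_mem (Finset.ne_of_mem_erase hj).symm hi
      rw [← (s.erase j).prod_erase_mul _ this, sub_self, mul_zero, mul_zero]
    simp only [p, eval_finsetSum, eval_mul, eval_C, eval_prod, eval_sub, eval_X, eval_zero] at h2
    rw [← s.sum_erase_add _ hi, Finset.sum_eq_zero h3, zero_add] at h2
    exact eq_zero_of_ne_zero_of_mul_right_eq_zero (Finset.prod_ne_zero_iff.2 fun j hj ↦
      sub_ne_zero.2 (Finset.ne_of_mem_erase hj).symm) h2
  have h1 := hli.cardinal_lift_le_rank
  have h2 : Cardinal.lift.{v} (Cardinal.mk k) ≤ Cardinal.aleph0 :=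
    h1.trans (by simpa using hV)
  rw [Cardinal.lift_le_aleph0, Cardinal.mk_le_aleph0_iff] at h2
  exact not_countable h2

/-- Schur's lemma (Dixmier): an endomorphism commuting with an irreducible representation of
countable dimension over an uncountable algebraically closed field is a scalar. -/
theorem Representation.IsIrreducible.exists_eq_smul_of_commute {k : Type u} [Field k]
    [IsAlgClosed k] [Uncountable k] {G : Type w} [Group G] {V : Type v} [AddCommGroup V]
    [Module k V] (hV : Module.rank k V ≤ Cardinal.aleph0) {ρ : Representation k G V}
    (hρ : ρ.IsIrreducible) (φ : V →ₗ[k] V) (hφ : ∀ g v, φ (ρ g v) = ρ g (φ v)) :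
    ∃ c : k, ∀ v, φ v = c • v := by
  have htriv (S : Subrepresentation ρ) : S.toSubmodule = ⊥ ∨ S.toSubmodule = ⊤ :=
    (IsSimpleOrder.eq_bot_or_eq_top S).imp (fun h ↦ by rw [h]; rfl) (fun h ↦ by rw [h]; rfl)
  have : Nontrivial V := by
    by_contra h
    rw [not_nontrivial_iff_subsingleton] at h
    exact bot_ne_top (α := Subrepresentation ρ)
      (Subrepresentation.toSubmodule_injective (Subsingleton.elim _ _))
  obtain ⟨c, hc⟩ := Module.End.spectrum_nonempty_of_rank_le_aleph0 hV φ
  refine ⟨c, ?_⟩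
  let ψ : V →ₗ[k] V := φ - algebraMap k (Module.End k V) c
  have hψ (v : V) : ψ v = φ v - c • v := rfl
  have hcomm (g v) : ψ (ρ g v) = ρ g (ψ v) := by simp only [hψ, hφ, map_sub, map_smul]
  -- Kernel and range of `ψ` are invariant. If `ψ` were neither zero nor non-injective it would be
  -- bijective, so `c` would not be in the spectrum.
  let K : Subrepresentation ρ := ⟨LinearMap.ker ψ, fun g v hv ↦ by
    rw [LinearMap.mem_ker] at hv ⊢; rw [hcomm, hv, map_zero]⟩
  let R : Subrepresentation ρ := ⟨LinearMap.range ψ, by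
    rintro g _ ⟨v, rfl⟩; exact ⟨ρ g v, hcomm g v⟩⟩
  rcases htriv K with hK | hK
  · rcases htriv R with hR | hR
    · intro v
      have : ψ v ∈ R.toSubmodule := ⟨v, rfl⟩
      rw [hR, Submodule.mem_bot, hψ] at this
      exact sub_eq_zero.1 this
    · exfalso
      have hb : IsUnit ψ := (Module.End.isUnit_iff _).2
        ⟨LinearMap.ker_eq_bot.1 hK, LinearMap.range_eq_top.1 hR⟩
      rw [spectrum.mem_iff] at hc
      apply hc
      rw [← IsUnit.neg_iff, neg_sub]
      exact hb
  · intro v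
    have : v ∈ K.toSubmodule := hK ▸ Submodule.mem_top
    exact sub_eq_zero.1 ((hψ v).symm.trans this)

/-- Linearly independent equivariant maps out of an irreducible representation with scalar
endomorphisms are jointly injective. -/
theorem Representation.IsIrreducible.eq_zero_of_sum_apply_eq_zero {k : Type u} [Field k]
    [IsAlgClosed k] [Uncountable k] {G : Type w} [Group G] {V : Type v} [AddCommGroup V]
    [Module k V] (hV : Module.rank k V ≤ Cardinal.aleph0) {ρ : Representation k G V}
    (hρ : ρ.IsIrreducible) {M : Type*} [AddCommGroup M] [Module k M]
    (σ : Representation k G M) {ι : Type*} (f : ι → V →ₗ[k] M)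
    (hf : ∀ i g v, f i (ρ g v) = σ g (f i v)) (hli : LinearIndependent k f) (s : Finset ι) :
    ∀ v : ι → V, ∑ i ∈ s, f i (v i) = 0 → ∀ i ∈ s, v i = 0 := by
  classical
  induction s using Finset.induction_on with
  | empty => simp
  | insert j s hj ih =>
    intro v hv
    -- The `j`-th coordinates of all relations form a subrepresentation. If it is zero, the
    -- induction hypothesis finishes. If it is everything, the other coordinates are functions `e`
    -- of the `j`-th one, unique by induction, hence linear and equivariant, hence scalars, and `f`
    -- is linearly dependent.
    let K : Subrepresentation ρ :=
      { toSubmodule :=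
          { carrier := {x | ∃ v : ι → V, v j = x ∧ ∑ i ∈ insert j s, f i (v i) = 0}
            zero_mem' := ⟨0, rfl, by simp⟩
            add_mem' := by
              rintro _ _ ⟨x, rfl, hx⟩ ⟨y, rfl, hy⟩
              exact ⟨x + y, rfl, by
                simp only [Pi.add_apply, map_add, Finset.sum_add_distrib, hx, hy, add_zero]⟩
            smul_mem' := by
              rintro c _ ⟨x, rfl, hx⟩
              exact ⟨c • x, rfl, by
                simp only [Pi.smul_apply, map_smul, ← Finset.smul_sum, hx, smul_zero]⟩ }
        apply_mem_toSubmodule := by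
          rintro g _ ⟨x, rfl, hx⟩
          exact ⟨fun i ↦ ρ g (x i), rfl, by simp only [hf, ← map_sum, hx, map_zero]⟩ }
    have hK : K.toSubmodule = ⊥ ∨ K.toSubmodule = ⊤ :=
      (IsSimpleOrder.eq_bot_or_eq_top K).imp (fun h ↦ by rw [h]; rfl) (fun h ↦ by rw [h]; rfl)
    rcases hK with hK | hK
    · have hvj : v j = 0 := by
        have : v j ∈ K.toSubmodule := ⟨v, rfl, hv⟩
        rwa [hK, Submodule.mem_bot] at this
      rw [Finset.sum_insert hj, hvj, map_zero, zero_add] at hv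
      intro i hi
      rcases Finset.mem_insert.1 hi with rfl | hi
      · exact hvj
      · exact ih v hv i hi
    · exfalso
      have hall (x : V) : ∃ v : ι → V, v j = x ∧ ∑ i ∈ insert j s, f i (v i) = 0 := by
        have : x ∈ K.toSubmodule := hK ▸ Submodule.mem_top
        exact this
      choose e he1 he2 using hall
      have huniq (x : V) (y : ι → V) (hy1 : y j = x) (hy2 : ∑ i ∈ insert j s, f i (y i) = 0)
          (i) (hi : i ∈ s) : y i = e x i := by
        refine sub_eq_zero.1 (ih (y - e x) ?_ i hi)
        have h3 := (congr($hy2 - $(he2 x))).trans (sub_self _)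
        rw [Finset.sum_insert hj, Finset.sum_insert hj, hy1, he1, add_sub_add_left_eq_sub] at h3
        simpa using h3
      have hsc (i) (hi : i ∈ s) : ∃ c : k, ∀ x, e x i = c • x := by
        refine hρ.exists_eq_smul_of_commute hV
          { toFun := fun x ↦ e x i
            map_add' := fun x y ↦ ?_
            map_smul' := fun c x ↦ ?_ } fun g x ↦ ?_
        · refine (huniq (x + y) (e x + e y) ?_ ?_ i hi).symm
          · simp [he1]
          · simp only [Pi.add_apply, map_add, Finset.sum_add_distrib, he2, add_zero]
        · refine (huniq (c • x) (c • e x) ?_ ?_ i hi).symm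
          · simp [he1]
          · simp only [Pi.smul_apply, map_smul, ← Finset.smul_sum, he2, smul_zero]
        · refine (huniq (ρ g x) (fun i ↦ ρ g (e x i)) ?_ ?_ i hi).symm
          · simp [he1]
          · simp only [hf, ← map_sum, he2, map_zero]
      choose! c hc using hsc
      have hrel : ∑ i ∈ insert j s, (Function.update c j 1) i • f i = 0 := by
        ext x
        rw [LinearMap.zero_apply, ← he2 x, Finset.sum_insert hj, Finset.sum_insert hj,
          LinearMap.add_apply, LinearMap.sum_apply, Function.update_self, one_smul, he1]
        congr 1
        refine Finset.sum_congr rfl fun i hi ↦ ?_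
        rw [Function.update_of_ne (ne_of_mem_of_not_mem hi hj), hc i hi, map_smul,
          LinearMap.smul_apply]
      have := linearIndependent_iff'.1 hli _ _ hrel j (Finset.mem_insert_self _ _)
      rw [Function.update_self] at this
      exact one_ne_zero this

/-- Linearly independent functionals take arbitrary prescribed values. -/
theorem LinearIndependent.exists_dual_apply_eq {k : Type u} [Field k] {V : Type v}
    [AddCommGroup V] [Module k V] {ι : Type*} [Finite ι] {f : ι → Module.Dual k V}
    (hf : LinearIndependent k f) (c : ι → k) : ∃ x, ∀ i, f i x = c i := by
  classical
  have := Fintype.ofFinite ι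
  -- Surjectivity is injectivity of the dual map, which turns `l` into the combination of the `f i`
  -- with coefficients `l (Pi.single i 1)`.
  have hs : Function.Surjective (LinearMap.pi f) := by
    rw [← LinearMap.dualMap_injective_iff, injective_iff_map_eq_zero]
    intro l hl
    have h := Fintype.linearIndependent_iff.1 hf (fun i ↦ l (Pi.single i 1)) (by
      ext x
      have h := congr($hl x)
      rw [LinearMap.dualMap_apply, LinearMap.zero_apply,
        pi_eq_sum_univ' (LinearMap.pi f x), map_sum] at h
      rw [LinearMap.zero_apply, ← h, LinearMap.sum_apply]
      refine Finset.sum_congr rfl fun i _ ↦ ?_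
      rw [LinearMap.smul_apply, map_smul, smul_eq_mul, smul_eq_mul, mul_comm]
      congr 2)
    ext i
    simpa using h i
  obtain ⟨x, hx⟩ := hs c
  exact ⟨x, fun i ↦ congr($hx i)⟩

-- Joint nondegeneracy and linear conditions

namespace MultiQuadratic

/-- A family of bilinear forms is jointly nondegenerate if the map `V^ι → V^*` that it induces is
injective. -/
def JointlyNondegenerate {k : Type u} [Field k] {V : Type v} [AddCommGroup V] [Module k V]
    {ι : Type*} [Fintype ι] (ω : ι → LinearMap.BilinForm k V) : Prop :=
  ∀ v : ι → V, (∀ x, ∑ i, ω i (v i) x = 0) → v = 0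

/-- Invariance of a form says that it intertwines `V` with the dual representation, so independent
forms are jointly injective by Schur's lemma. -/
theorem IsIrreducible.jointlyNondegenerate {k : Type u} [Field k] [IsAlgClosed k] [Uncountable k]
    {r : ℕ} {V : Type v} [AddCommGroup V] [Module k V] {A : MultiQuadratic k r V}
    (hA : A.IsIrreducible) (hV : Module.rank k V ≤ Cardinal.aleph0) {ι : Type*} [Fintype ι]
    {a : ι → Fin r} (ha : LinearIndependent k (A.form ∘ a)) :
    JointlyNondegenerate (A.form ∘ a) := by
  intro v hv
  funext i
  refine Representation.IsIrreducible.eq_zero_of_sum_apply_eq_zero hV hA A.autRep.dual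
    (A.form ∘ a) (fun i g x ↦ ?_) ha Finset.univ v ?_ i (Finset.mem_univ i)
  · ext y
    rw [Representation.dual_apply, Module.Dual.transpose_apply]
    have h := g⁻¹.2 (a i) (A.autRep g x) y
    have h1 : (↑g⁻¹ : V ≃ₗ[k] V) (A.autRep g x) = x := A.autRep.inv_self_apply g x
    rw [h1] at h
    exact h.symm
  · ext x
    simpa using hv x

section Solve

variable {k : Type u} [Field k] {V : Type v} [AddCommGroup V] [Module k V] {ι : Type*} [Fintype ι]
  {ω : ι → LinearMap.BilinForm k V}

/-- Joint nondegeneracy makes the functionals `ω i (x j)` independent, so their values can be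
prescribed. Their common kernel has finite codimension, which leaves room to leave the span. -/
theorem JointlyNondegenerate.exists_notMem_span (hω : JointlyNondegenerate ω)
    (hV : ¬ FiniteDimensional k V) {n : ℕ} {x : Fin n → V} (hx : LinearIndependent k x)
    (c : ι → Fin n → k) :
    ∃ y, y ∉ Submodule.span k (Set.range x) ∧ ∀ i j, ω i (x j) y = c i j := by
  have hli : LinearIndependent k (fun p : ι × Fin n ↦ (ω p.1 (x p.2) : Module.Dual k V)) := by
    rw [Fintype.linearIndependent_iff]
    intro g hg
    have h0 := hω (fun i ↦ ∑ j, g (i, j) • x j) (fun y ↦ by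
      have := congr($hg y)
      rw [Fintype.sum_prod_type] at this
      simpa using this)
    rintro ⟨i, j⟩
    exact Fintype.linearIndependent_iff.1 hx (fun j ↦ g (i, j)) (congr_fun h0 i) j
  obtain ⟨y, hy⟩ := hli.exists_dual_apply_eq (fun p ↦ c p.1 p.2)
  by_cases hmem : y ∈ Submodule.span k (Set.range x)
  · let F : V →ₗ[k] (ι × Fin n → k) := LinearMap.pi fun p ↦ ω p.1 (x p.2)
    have hF : ¬ LinearMap.ker F ≤ Submodule.span k (Set.range x) := fun hle ↦ by
      have hfin : FiniteDimensional k (LinearMap.ker F) :=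
        have := FiniteDimensional.span_of_finite k (Set.finite_range x)
        Submodule.finiteDimensional_of_le hle
      have := Module.Finite.equiv F.quotKerEquivRange.symm
      exact hV (Module.Finite.of_submodule_quotient (LinearMap.ker F))
    obtain ⟨z, hz, hz'⟩ := SetLike.not_le_iff_exists.1 hF
    refine ⟨y + z, fun h ↦ hz' ((Submodule.add_mem_iff_right _ hmem).1 h), fun i j ↦ ?_⟩
    have h1 : ω i (x j) z = 0 := congr_fun hz (i, j)
    rw [map_add, hy (i, j), h1, add_zero]
  · exact ⟨y, hmem, fun i j ↦ hy (i, j)⟩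

end Solve

end MultiQuadratic

/-- Over an algebraically closed field of characteristic not two, more than `|ι|` vectors of `k^ι`
satisfy a linear relation whose coefficients are squares of scalars with sum one. -/
theorem IsAlgClosed.exists_sum_eq_one_sum_sq_smul_eq_zero {k : Type u} [Field k] [IsAlgClosed k]
    (h2 : (2 : k) ≠ 0) {α ι : Type*} [Fintype α] [Fintype ι]
    (hcard : Fintype.card ι < Fintype.card α) (d : α → ι → k) :
    ∃ c : α → k, ∑ a, c a = 1 ∧ ∑ a, (c a) ^ 2 • d a = 0 := by
  classical
  have hd : ¬ LinearIndependent k d := fun h ↦ by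
    have := h.fintype_card_le_finrank
    rw [Module.finrank_fintype_fun_eq_card] at this
    omega
  obtain ⟨l, hl, a, ha⟩ := Fintype.not_linearIndependent_iff.1 hd
  choose s hs using fun b ↦ IsAlgClosed.exists_pow_nat_eq (l b) two_pos
  have hsa : s a ≠ 0 := fun h ↦ ha (by rw [← hs, h, zero_pow two_ne_zero])
  obtain ⟨t, ht, hts⟩ : ∃ t : α → k, ∑ b, t b ≠ 0 ∧ ∀ b, t b ^ 2 = l b := by
    by_cases h0 : ∑ b, s b = 0
    -- Flipping the sign of one nonzero root keeps the squares and changes the sum by `-2 * s a`,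
    -- which is nonzero in characteristic not two.
    · refine ⟨Function.update s a (-s a), ?_, fun b ↦ ?_⟩
      · rw [Finset.sum_update_of_mem (Finset.mem_univ a)]
        rw [← Finset.add_sum_erase _ _ (Finset.mem_univ a), ← Finset.sdiff_singleton_eq_erase] at h0
        exact fun h ↦ mul_ne_zero h2 hsa (by linear_combination h0 - h)
      · rcases eq_or_ne b a with rfl | hb
        · rw [Function.update_self, neg_sq, hs]
        · rw [Function.update_of_ne hb, hs]
    · exact ⟨s, h0, hs⟩
  refine ⟨fun b ↦ (∑ b, t b)⁻¹ * t b, ?_, ?_⟩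
  · rw [← Finset.mul_sum, inv_mul_cancel₀ ht]
  · simp only [mul_pow, hts, mul_smul, ← Finset.smul_sum, hl, smul_zero]

-- Prescribing self-products

namespace MultiQuadratic

section Extension

variable {k : Type u} [Field k] {V : Type v} [AddCommGroup V] [Module k V] {ι : Type*} [Fintype ι]
  {ω : ι → LinearMap.BilinForm k V}

/-- Supplies many solutions of the same linear conditions: combinations with coefficient sum one
remain solutions, and orthogonality makes their self-products diagonal in the coefficients. -/
theorem JointlyNondegenerate.exists_orthogonal (hω : JointlyNondegenerate ω)
    (hsymm : ∀ i x y, ω i x y = ω i y x) (hV : ¬ FiniteDimensional k V) (N : ℕ) {n : ℕ}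
    {x : Fin n → V} (hx : LinearIndependent k x) (c : ι → Fin n → k) :
    ∃ y : Fin N → V,
      (∀ g : Fin N → k, ∑ a, g a • y a ∈ Submodule.span k (Set.range x) → g = 0) ∧
      (∀ i j a, ω i (x j) (y a) = c i j) ∧ ∀ i a b, a ≠ b → ω i (y a) (y b) = 0 := by
  induction N generalizing n with
  | zero => exact ⟨Fin.elim0, fun g _ ↦ Subsingleton.elim _ _, fun _ _ a ↦ a.elim0,
      fun _ a ↦ a.elim0⟩
  | succ N ih =>
    obtain ⟨z, hz, hzc⟩ := hω.exists_notMem_span hV hx c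
    -- The appended value 0 makes all later vectors orthogonal to `z`.
    obtain ⟨y, hy1, hy2, hy3⟩ := ih (hx.finSnoc hz) (fun i ↦ Fin.snoc (c i) 0)
    have hz0 (i a) : ω i z (y a) = 0 := by simpa using hy2 i (Fin.last n) a
    have hle : Submodule.span k (Set.range x) ≤
        Submodule.span k (Set.range (Fin.snoc x z : Fin (n + 1) → V)) :=
      Submodule.span_mono (by
        rintro _ ⟨j, rfl⟩
        exact ⟨j.castSucc, Fin.snoc_castSucc (α := fun _ ↦ V) _ _ _⟩)
    have hzmem : z ∈ Submodule.span k (Set.range (Fin.snoc x z : Fin (n + 1) → V)) :=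
      Submodule.subset_span ⟨Fin.last n, Fin.snoc_last (α := fun _ ↦ V) _ _⟩
    refine ⟨Fin.cons z y, fun g hg ↦ ?_, fun i j a ↦ ?_, fun i a b hab ↦ ?_⟩
    · rw [Fin.sum_univ_succ] at hg
      simp only [Fin.cons_zero, Fin.cons_succ] at hg
      have htail := hy1 (fun a ↦ g a.succ)
        ((Submodule.add_mem_iff_right _ (Submodule.smul_mem _ (g 0) hzmem)).1 (hle hg))
      have h0 (a : Fin N) : g a.succ = 0 := congr_fun htail a
      simp only [h0, zero_smul, Finset.sum_const_zero, add_zero] at hg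
      have h1 : g 0 = 0 := by
        by_contra h
        exact hz ((Submodule.smul_mem_iff _ h).1 hg)
      ext a
      exact Fin.cases h1 h0 a
    · refine Fin.cases ?_ (fun a ↦ ?_) a
      · exact hzc i j
      · simpa using hy2 i j.castSucc a
    · induction a using Fin.cases with
      | zero =>
        induction b using Fin.cases with
        | zero => exact absurd rfl hab
        | succ b => exact hz0 i b
      | succ a =>
        induction b using Fin.cases with
        | zero => exact (hsymm i _ _).trans (hz0 i a)
        | succ b => exact hy3 i a b (fun h ↦ hab (congrArg _ h))

variable [IsAlgClosed k]

/-- One more orthogonal solution than there are forms suffices: some weights of sum one have squares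
annihilating all the self-products. -/
theorem JointlyNondegenerate.exists_isotropic (hω : JointlyNondegenerate ω) (h2 : (2 : k) ≠ 0)
    (hsymm : ∀ i x y, ω i x y = ω i y x) (hV : ¬ FiniteDimensional k V) {n : ℕ}
    {x : Fin n → V} (hx : LinearIndependent k x) (c : ι → Fin n → k) :
    ∃ y, y ∉ Submodule.span k (Set.range x) ∧ (∀ i j, ω i (x j) y = c i j) ∧
      ∀ i, ω i y y = 0 := by
  obtain ⟨y, hy1, hy2, hy3⟩ := hω.exists_orthogonal hsymm hV (Fintype.card ι + 1) hx c
  obtain ⟨g, hg1, hg2⟩ := IsAlgClosed.exists_sum_eq_one_sum_sq_smul_eq_zero h2 (by simp)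
    (fun a i ↦ ω i (y a) (y a))
  refine ⟨∑ a, g a • y a, fun h ↦ ?_, fun i j ↦ ?_, fun i ↦ ?_⟩
  · rw [hy1 g h] at hg1
    simp at hg1
  · simp only [map_sum, map_smul, hy2, smul_eq_mul, ← Finset.sum_mul, hg1, one_mul]
  · have h := congr_fun hg2 i
    simp only [Finset.sum_apply, Pi.smul_apply, smul_eq_mul, Pi.zero_apply] at h
    rw [← h]
    simp only [map_sum, map_smul, LinearMap.sum_apply, LinearMap.smul_apply, smul_eq_mul]
    refine Finset.sum_congr rfl fun a _ ↦ ?_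
    rw [Finset.sum_eq_single a (fun b _ hb ↦ by rw [hy3 i b a hb, mul_zero])
      (fun h ↦ absurd (Finset.mem_univ a) h), sq, mul_assoc]

/-- In a jointly nondegenerate space of infinite dimension one can find a vector whose products
with given linearly independent vectors and with itself are prescribed. -/
theorem JointlyNondegenerate.exists_extension (hω : JointlyNondegenerate ω) (h2 : (2 : k) ≠ 0)
    (hsymm : ∀ i x y, ω i x y = ω i y x) (hV : ¬ FiniteDimensional k V) {n : ℕ}
    {x : Fin n → V} (hx : LinearIndependent k x) (c : ι → Fin n → k) (t : ι → k) :
    ∃ y, y ∉ Submodule.span k (Set.range x) ∧ (∀ i j, ω i (x j) y = c i j) ∧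
      ∀ i, ω i y y = t i := by
  obtain ⟨z, hz1, hz2, hz3⟩ := hω.exists_isotropic h2 hsymm hV hx 0
  -- As `z` and `y` are isotropic, `z + y` has self-product twice `ω i z y`, hence the value `t i /
  -- 2`; `z` is orthogonal to the `x j`, so it does not disturb `c`.
  obtain ⟨y, hy1, hy2, hy3⟩ := hω.exists_isotropic h2 hsymm hV (hx.finSnoc hz1)
    (fun i ↦ Fin.snoc (c i) (t i / 2))
  have hle : Submodule.span k (Set.range x) ≤
      Submodule.span k (Set.range (Fin.snoc x z : Fin (n + 1) → V)) :=
    Submodule.span_mono (by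
      rintro _ ⟨j, rfl⟩
      exact ⟨j.castSucc, Fin.snoc_castSucc (α := fun _ ↦ V) _ _ _⟩)
  have hzmem : z ∈ Submodule.span k (Set.range (Fin.snoc x z : Fin (n + 1) → V)) :=
    Submodule.subset_span ⟨Fin.last n, Fin.snoc_last (α := fun _ ↦ V) _ _⟩
  have hzy (i) : ω i z y = t i / 2 := by simpa using hy2 i (Fin.last n)
  refine ⟨z + y, fun h ↦ hy1 ((Submodule.add_mem_iff_right _ hzmem).1 (hle h)), fun i j ↦ ?_,
    fun i ↦ ?_⟩
  · have h1 : ω i (x j) y = c i j := by simpa using hy2 i j.castSucc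
    rw [map_add, hz2, h1, Pi.zero_apply, Pi.zero_apply, zero_add]
  · rw [map_add, map_add, LinearMap.add_apply, LinearMap.add_apply, hz3, hy3, hsymm i y z, hzy]
    field_simp
    ring

/-- Every Gram matrix is realised by linearly independent vectors in a jointly nondegenerate space
of infinite dimension. -/
theorem JointlyNondegenerate.exists_gram (hω : JointlyNondegenerate ω) (h2 : (2 : k) ≠ 0)
    (hsymm : ∀ i x y, ω i x y = ω i y x) (hV : ¬ FiniteDimensional k V) {n : ℕ}
    (G : ι → Fin n → Fin n → k) (hG : ∀ i a b, G i a b = G i b a) :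
    ∃ x : Fin n → V, LinearIndependent k x ∧ ∀ i a b, ω i (x a) (x b) = G i a b := by
  induction n with
  | zero => exact ⟨Fin.elim0, linearIndependent_empty_type, fun _ a ↦ a.elim0⟩
  | succ n ih =>
    obtain ⟨x, hx, hxG⟩ := ih (fun i a b ↦ G i a.castSucc b.castSucc) (fun i a b ↦ hG _ _ _)
    obtain ⟨y, hy1, hy2, hy3⟩ := hω.exists_extension h2 hsymm hV hx
      (fun i j ↦ G i j.castSucc (Fin.last n)) (fun i ↦ G i (Fin.last n) (Fin.last n))
    refine ⟨Fin.snoc x y, hx.finSnoc hy1, fun i a b ↦ ?_⟩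
    induction a using Fin.lastCases with
    | last =>
      induction b using Fin.lastCases with
      | last => simpa using hy3 i
      | cast b => simpa [hsymm i y, hG i (Fin.last n)] using hy2 i b
    | cast a =>
      induction b using Fin.lastCases with
      | last => simpa using hy2 i a
      | cast b => simpa using hxG i a b

end Extension

end MultiQuadratic

-- Back and forth

namespace MultiQuadratic

section BackAndForth

variable {k : Type u} [Field k] {V : Type v} [AddCommGroup V] [Module k V]
  {W : Type w} [AddCommGroup W] [Module k W] {ι : Type*}

/-- A subspace of `V × W` is a partial isometry if it is the graph of an injective linear map from
a subspace of `V` to `W` that respects the forms. -/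
structure IsPartialIsometry (ω : ι → LinearMap.BilinForm k V) (ω' : ι → LinearMap.BilinForm k W)
    (Γ : Submodule k (V × W)) : Prop where
  form_eq : ∀ p ∈ Γ, ∀ q ∈ Γ, ∀ i, ω i p.1 q.1 = ω' i p.2 q.2
  fst_eq_zero_iff : ∀ p ∈ Γ, p.1 = 0 ↔ p.2 = 0

variable {ω : ι → LinearMap.BilinForm k V} {ω' : ι → LinearMap.BilinForm k W}
  {Γ : Submodule k (V × W)}

theorem IsPartialIsometry.bot : IsPartialIsometry ω ω' ⊥ where
  form_eq p hp q hq i := by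
    rw [Submodule.mem_bot] at hp hq
    simp [hp, hq]
  fst_eq_zero_iff p hp := by
    rw [Submodule.mem_bot] at hp
    simp [hp]

theorem IsPartialIsometry.swap (h : IsPartialIsometry ω ω' Γ) :
    IsPartialIsometry ω' ω (Γ.map (LinearEquiv.prodComm k V W).toLinearMap) where
  form_eq := by
    rintro _ ⟨p, hp, rfl⟩ _ ⟨q, hq, rfl⟩ i
    exact (h.form_eq p hp q hq i).symm
  fst_eq_zero_iff := by
    rintro _ ⟨p, hp, rfl⟩
    exact (h.fst_eq_zero_iff p hp).symm

/-- The span of pairs of linearly independent families with the same Gram matrix. -/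
theorem IsPartialIsometry.span_range {n : ℕ} {x : Fin n → V} {y : Fin n → W}
    (hx : LinearIndependent k x) (hy : LinearIndependent k y)
    (hxy : ∀ i a b, ω i (x a) (x b) = ω' i (y a) (y b)) :
    IsPartialIsometry ω ω' (Submodule.span k (Set.range fun a ↦ (x a, y a))) where
  form_eq p hp q hq i := by
    obtain ⟨c, rfl⟩ := (Submodule.mem_span_range_iff_exists_fun k).1 hp
    obtain ⟨d, rfl⟩ := (Submodule.mem_span_range_iff_exists_fun k).1 hq
    simp [Prod.fst_sum, Prod.snd_sum, hxy]
  fst_eq_zero_iff p hp := by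
    obtain ⟨c, rfl⟩ := (Submodule.mem_span_range_iff_exists_fun k).1 hp
    simp only [Prod.fst_sum, Prod.snd_sum, Prod.smul_mk]
    constructor <;> intro h
    · simp [Fintype.linearIndependent_iff.1 hx c h]
    · simp [Fintype.linearIndependent_iff.1 hy c h]

theorem IsPartialIsometry.sup_span (h : IsPartialIsometry ω ω' Γ)
    (hsymm : ∀ i x y, ω i x y = ω i y x) (hsymm' : ∀ i x y, ω' i x y = ω' i y x) {v : V} {y : W}
    (hv : v ∉ Γ.map (LinearMap.fst k V W)) (hy : y ∉ Γ.map (LinearMap.snd k V W))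
    (hvy : ∀ p ∈ Γ, ∀ i, ω i p.1 v = ω' i p.2 y) (hself : ∀ i, ω i v v = ω' i y y) :
    IsPartialIsometry ω ω' (Γ ⊔ Submodule.span k {(v, y)}) where
  form_eq p hp q hq i := by
    obtain ⟨p, hpΓ, _, hp', rfl⟩ := Submodule.mem_sup.1 hp
    obtain ⟨a, rfl⟩ := Submodule.mem_span_singleton.1 hp'
    obtain ⟨q, hqΓ, _, hq', rfl⟩ := Submodule.mem_sup.1 hq
    obtain ⟨b, rfl⟩ := Submodule.mem_span_singleton.1 hq'
    simp only [Prod.fst_add, Prod.snd_add, Prod.smul_fst, Prod.smul_snd, map_add, map_smul,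
      LinearMap.add_apply, LinearMap.smul_apply, h.form_eq p hpΓ q hqΓ, hvy p hpΓ, hself,
      hsymm i v q.1, hsymm' i y q.2, hvy q hqΓ]
  fst_eq_zero_iff p hp := by
    obtain ⟨p, hpΓ, _, hp', rfl⟩ := Submodule.mem_sup.1 hp
    obtain ⟨a, rfl⟩ := Submodule.mem_span_singleton.1 hp'
    by_cases ha : a = 0
    · simpa [ha] using h.fst_eq_zero_iff p hpΓ
    · refine iff_of_false (fun h0 ↦ hv ?_) (fun h0 ↦ hy ?_)
      · rw [← Submodule.smul_mem_iff _ ha, ← Submodule.add_mem_iff_right _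
          (Submodule.mem_map_of_mem (f := LinearMap.fst k V W) hpΓ)]
        exact (congrArg (· ∈ Γ.map (LinearMap.fst k V W)) h0).mpr (zero_mem _)
      · rw [← Submodule.smul_mem_iff _ ha, ← Submodule.add_mem_iff_right _
          (Submodule.mem_map_of_mem (f := LinearMap.snd k V W) hpΓ)]
        exact (congrArg (· ∈ Γ.map (LinearMap.snd k V W)) h0).mpr (zero_mem _)

variable [Fintype ι] [IsAlgClosed k]

/-- The forth step: finite dimensional partial isometries extend to any further vector. -/
theorem IsPartialIsometry.exists_le_mem_map_fst (h : IsPartialIsometry ω ω' Γ)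
    [FiniteDimensional k Γ] (h2 : (2 : k) ≠ 0)
    (hsymm : ∀ i x y, ω i x y = ω i y x) (hsymm' : ∀ i x y, ω' i x y = ω' i y x)
    (hω' : JointlyNondegenerate ω') (hW : ¬ FiniteDimensional k W) (v : V) :
    ∃ Γ' : Submodule k (V × W), FiniteDimensional k Γ' ∧ IsPartialIsometry ω ω' Γ' ∧ Γ ≤ Γ' ∧
      v ∈ Γ'.map (LinearMap.fst k V W) := by
  by_cases hv : v ∈ Γ.map (LinearMap.fst k V W)
  · exact ⟨Γ, ‹_›, h, le_rfl, hv⟩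
  let b := Module.finBasis k Γ
  have hspan (p) (hp : p ∈ Γ) : ∃ c : Fin _ → k, ∑ j, c j • (b j : V × W) = p := by
    refine ⟨b.repr ⟨p, hp⟩, ?_⟩
    have := congrArg Γ.subtype (b.sum_repr ⟨p, hp⟩)
    rw [map_sum] at this
    exact this
  have hli : LinearIndependent k (fun j ↦ (b j : V × W).2) := by
    have := b.linearIndependent.map' (LinearMap.snd k V W ∘ₗ Γ.subtype) (by
      rw [LinearMap.ker_eq_bot']
      rintro ⟨p, hp⟩ hp2
      have h1 := (h.fst_eq_zero_iff p hp).2 hp2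
      exact Subtype.ext (Prod.ext h1 hp2))
    exact this
  -- The image of `v` must have the products with the second coordinates of the basis that `v` has
  -- with the first ones.
  obtain ⟨y, hy1, hy2, hy3⟩ := hω'.exists_extension h2 hsymm' hW hli
    (fun i j ↦ ω i (b j : V × W).1 v) (fun i ↦ ω i v v)
  refine ⟨Γ ⊔ Submodule.span k {(v, y)}, inferInstance,
    h.sup_span hsymm hsymm' hv (fun hmem ↦ hy1 ?_) (fun p hp i ↦ ?_) (fun i ↦ (hy3 i).symm),
    le_sup_left, ⟨(v, y), Submodule.mem_sup_right (Submodule.mem_span_singleton_self _), rfl⟩⟩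
  · obtain ⟨p, hp, rfl⟩ := hmem
    obtain ⟨c, rfl⟩ := hspan p hp
    rw [map_sum]
    exact Submodule.sum_mem _ fun j _ ↦
      Submodule.smul_mem _ _ (Submodule.subset_span ⟨j, rfl⟩)
  · obtain ⟨c, rfl⟩ := hspan p hp
    simp [Prod.fst_sum, Prod.snd_sum, hy2]

/-- The forth step for the swapped graph. -/
theorem IsPartialIsometry.exists_le_mem_map_snd (h : IsPartialIsometry ω ω' Γ)
    [FiniteDimensional k Γ] (h2 : (2 : k) ≠ 0)
    (hsymm : ∀ i x y, ω i x y = ω i y x) (hsymm' : ∀ i x y, ω' i x y = ω' i y x)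
    (hω : JointlyNondegenerate ω) (hV : ¬ FiniteDimensional k V) (y : W) :
    ∃ Γ' : Submodule k (V × W), FiniteDimensional k Γ' ∧ IsPartialIsometry ω ω' Γ' ∧ Γ ≤ Γ' ∧
      y ∈ Γ'.map (LinearMap.snd k V W) := by
  obtain ⟨Γ', hfin, hΓ', hle, p, hp, rfl⟩ :=
    h.swap.exists_le_mem_map_fst h2 hsymm' hsymm hω hV y
  refine ⟨Γ'.map (LinearEquiv.prodComm k W V).toLinearMap, inferInstance, hΓ'.swap,
    fun q hq ↦ ⟨q.swap, hle ⟨q, hq, rfl⟩, rfl⟩, p.swap, ⟨p, hp, rfl⟩, rfl⟩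

/-- Back and forth: a finite dimensional partial isometry between jointly nondegenerate spaces of
countably infinite dimension extends to an isometry. -/
theorem IsPartialIsometry.exists_linearEquiv (h : IsPartialIsometry ω ω' Γ)
    [FiniteDimensional k Γ] (h2 : (2 : k) ≠ 0)
    (hsymm : ∀ i x y, ω i x y = ω i y x) (hsymm' : ∀ i x y, ω' i x y = ω' i y x)
    (hω : JointlyNondegenerate ω) (hω' : JointlyNondegenerate ω')
    (hV : Module.rank k V = Cardinal.aleph0) (hW : Module.rank k W = Cardinal.aleph0) :
    ∃ e : V ≃ₗ[k] W, (∀ i x y, ω' i (e x) (e y) = ω i x y) ∧ ∀ p ∈ Γ, e p.1 = p.2 := by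
  have hV' : ¬ FiniteDimensional k V := fun hf ↦
    (Module.rank_lt_aleph0_iff.2 hf).ne hV
  have hW' : ¬ FiniteDimensional k W := fun hf ↦
    (Module.rank_lt_aleph0_iff.2 hf).ne hW
  let bV := Module.Basis.ofVectorSpace k V
  let bW := Module.Basis.ofVectorSpace k W
  have hcV : Countable (Module.Basis.ofVectorSpaceIndex k V) := by
    rw [← Cardinal.mk_le_aleph0_iff, bV.mk_eq_rank'', hV]
  have hcW : Countable (Module.Basis.ofVectorSpaceIndex k W) := by
    rw [← Cardinal.mk_le_aleph0_iff, bW.mk_eq_rank'', hW]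
  let P := {Γ : Submodule k (V × W) // FiniteDimensional k Γ ∧ IsPartialIsometry ω ω' Γ}
  -- One cofinal set for each basis vector of either space. There are countably many, so some ideal
  -- of partial isometries containing `Γ` meets them all; its union `T` is the graph of the
  -- isometry.
  let D : Module.Basis.ofVectorSpaceIndex k V ⊕ Module.Basis.ofVectorSpaceIndex k W →
      Order.Cofinal P := Sum.elim
    (fun a ↦ ⟨{Γ | bV a ∈ Γ.1.map (LinearMap.fst k V W)}, fun Γ ↦ by
      have := Γ.2.1
      obtain ⟨Γ', h1, h2, h3, h4⟩ :=
        Γ.2.2.exists_le_mem_map_fst h2 hsymm hsymm' hω' hW' (bV a)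
      exact ⟨⟨Γ', h1, h2⟩, h4, h3⟩⟩)
    (fun a ↦ ⟨{Γ | bW a ∈ Γ.1.map (LinearMap.snd k V W)}, fun Γ ↦ by
      have := Γ.2.1
      obtain ⟨Γ', h1, h2, h3, h4⟩ :=
        Γ.2.2.exists_le_mem_map_snd h2 hsymm hsymm' hω hV' (bW a)
      exact ⟨⟨Γ', h1, h2⟩, h4, h3⟩⟩)
  have : Encodable (Module.Basis.ofVectorSpaceIndex k V ⊕ Module.Basis.ofVectorSpaceIndex k W) :=
    Encodable.ofCountable _
  let Γ₀ : P := ⟨Γ, ‹_›, h⟩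
  let I := Order.idealOfCofinals Γ₀ D
  let T : Submodule k (V × W) := ⨆ Δ : I, Δ.1.1
  have hdir : Directed (· ≤ ·) (fun Δ : I ↦ Δ.1.1) := fun Δ Δ' ↦ by
    obtain ⟨E, hE, h1, h2⟩ := I.directed Δ.1 Δ.2 Δ'.1 Δ'.2
    exact ⟨⟨E, hE⟩, h1, h2⟩
  have : Nonempty I := ⟨⟨Γ₀, Order.mem_idealOfCofinals _ _⟩⟩
  have hmem {p : V × W} : p ∈ T ↔ ∃ Δ : I, p ∈ Δ.1.1 := Submodule.mem_iSup_of_directed _ hdir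
  have hT : IsPartialIsometry ω ω' T :=
    { form_eq := fun p hp q hq i ↦ by
        obtain ⟨Δ, hΔ⟩ := hmem.1 hp
        obtain ⟨Δ', hΔ'⟩ := hmem.1 hq
        obtain ⟨E, h1, h2⟩ := hdir Δ Δ'
        exact E.1.2.2.form_eq p (h1 hΔ) q (h2 hΔ') i
      fst_eq_zero_iff := fun p hp ↦ by
        obtain ⟨Δ, hΔ⟩ := hmem.1 hp
        exact Δ.1.2.2.fst_eq_zero_iff p hΔ }
  have hfst : T.map (LinearMap.fst k V W) = ⊤ := by
    rw [eq_top_iff, ← bV.span_eq, Submodule.span_le]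
    rintro _ ⟨a, rfl⟩
    obtain ⟨Δ, hΔ, hΔI⟩ := Order.cofinal_meets_idealOfCofinals Γ₀ D (Sum.inl a)
    exact Submodule.map_mono (le_iSup (fun Δ : I ↦ Δ.1.1) ⟨Δ, hΔI⟩) hΔ
  have hsnd : T.map (LinearMap.snd k V W) = ⊤ := by
    rw [eq_top_iff, ← bW.span_eq, Submodule.span_le]
    rintro _ ⟨a, rfl⟩
    obtain ⟨Δ, hΔ, hΔI⟩ := Order.cofinal_meets_idealOfCofinals Γ₀ D (Sum.inr a)
    exact Submodule.map_mono (le_iSup (fun Δ : I ↦ Δ.1.1) ⟨Δ, hΔI⟩) hΔ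
  let e₁ : T ≃ₗ[k] V := LinearEquiv.ofBijective (LinearMap.fst k V W ∘ₗ T.subtype) (by
    constructor
    · rw [← LinearMap.ker_eq_bot, LinearMap.ker_eq_bot']
      rintro ⟨p, hp⟩ hp1
      exact Subtype.ext (Prod.ext hp1 ((hT.fst_eq_zero_iff p hp).1 hp1))
    · rw [← LinearMap.range_eq_top, LinearMap.range_comp, Submodule.range_subtype, hfst])
  let e₂ : T ≃ₗ[k] W := LinearEquiv.ofBijective (LinearMap.snd k V W ∘ₗ T.subtype) (by
    constructor
    · rw [← LinearMap.ker_eq_bot, LinearMap.ker_eq_bot']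
      rintro ⟨p, hp⟩ hp2
      exact Subtype.ext (Prod.ext ((hT.fst_eq_zero_iff p hp).2 hp2) hp2)
    · rw [← LinearMap.range_eq_top, LinearMap.range_comp, Submodule.range_subtype, hsnd])
  have he (p : T) : (e₁.symm.trans e₂) p.1.1 = p.1.2 := by
    have : e₁.symm p.1.1 = p := e₁.symm_apply_eq.2 rfl
    rw [LinearEquiv.trans_apply, this]
    rfl
  refine ⟨e₁.symm.trans e₂, fun i x y ↦ ?_, fun p hp ↦ ?_⟩
  · obtain ⟨p, rfl⟩ := e₁.surjective x
    obtain ⟨q, rfl⟩ := e₁.surjective y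
    have h1 := hT.form_eq p.1 p.2 q.1 q.2 i
    rw [← he p, ← he q] at h1
    exact h1.symm
  · exact he ⟨p, hmem.2 ⟨⟨Γ₀, Order.mem_idealOfCofinals _ _⟩, hp⟩⟩

end BackAndForth

end MultiQuadratic

-- Properties visible in the theory

namespace MultiQuadratic

section Sentences

variable {k : Type u} {r : ℕ}

/-- The sum of a finite sequence of scalar terms. -/
def ScalarTerm.sum [Field k] {m n : ℕ} :
    {s : ℕ} → (Fin s → ScalarTerm k r m n) → ScalarTerm k r m n
  | 0, _ => .const 0
  | _ + 1, f => .add (ScalarTerm.sum fun i ↦ f i.castSucc) (f (Fin.last _))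

/-- The sum of a finite sequence of vector terms. -/
def VectorTerm.sum {m n : ℕ} : {s : ℕ} → (Fin s → VectorTerm k r m n) → VectorTerm k r m n
  | 0, _ => .zero
  | _ + 1, f => .add (VectorTerm.sum fun i ↦ f i.castSucc) (f (Fin.last _))

/-- Negation. -/
def Formula.neg {m n : ℕ} (φ : Formula k r m n) : Formula k r m n :=
  .imp φ .falsum

/-- Universal closure over the vector variables. -/
def Formula.allVectors {m : ℕ} : {n : ℕ} → Formula k r m n → Formula k r m 0
  | 0, φ => φ
  | _ + 1, φ => Formula.allVectors (.allVector φ)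

/-- Universal closure over the scalar variables. -/
def Formula.allScalars {n : ℕ} : {m : ℕ} → Formula k r m n → Formula k r 0 n
  | 0, φ => φ
  | _ + 1, φ => Formula.allScalars (.allScalar φ)

variable [Field k] {V : Type v} [AddCommGroup V] [Module k V] (A : MultiQuadratic k r V)
  {m n : ℕ} (a : Fin m → k) (x : Fin n → V)

@[simp]
theorem ScalarTerm.eval_var (i : Fin m) :
    (ScalarTerm.var i : ScalarTerm k r m n).eval A a x = a i := by
  simp [ScalarTerm.eval, ScalarTerm.evalLift]

@[simp]
theorem ScalarTerm.eval_const (c : k) :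
    (ScalarTerm.const c : ScalarTerm k r m n).eval A a x = c := by
  simp [ScalarTerm.eval, ScalarTerm.evalLift]

@[simp]
theorem ScalarTerm.eval_add (s t : ScalarTerm k r m n) :
    (ScalarTerm.add s t).eval A a x = s.eval A a x + t.eval A a x := by
  simp [ScalarTerm.eval, ScalarTerm.evalLift]

@[simp]
theorem ScalarTerm.eval_mul (s t : ScalarTerm k r m n) :
    (ScalarTerm.mul s t).eval A a x = s.eval A a x * t.eval A a x := by
  simp [ScalarTerm.eval, ScalarTerm.evalLift]

@[simp]
theorem ScalarTerm.eval_form (i : Fin r) (s t : VectorTerm k r m n) :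
    (ScalarTerm.form i s t).eval A a x = A.form i (s.eval A a x) (t.eval A a x) := by
  simp [ScalarTerm.eval, ScalarTerm.evalLift, VectorTerm.eval]

@[simp]
theorem VectorTerm.eval_var (i : Fin n) :
    (VectorTerm.var i : VectorTerm k r m n).eval A a x = x i := by
  simp [VectorTerm.eval, VectorTerm.evalLift]

@[simp]
theorem VectorTerm.eval_zero : (VectorTerm.zero : VectorTerm k r m n).eval A a x = 0 := by
  simp [VectorTerm.eval, VectorTerm.evalLift]

@[simp]
theorem VectorTerm.eval_add (s t : VectorTerm k r m n) :
    (VectorTerm.add s t).eval A a x = s.eval A a x + t.eval A a x := by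
  simp [VectorTerm.eval, VectorTerm.evalLift]

@[simp]
theorem VectorTerm.eval_smul (s : ScalarTerm k r m n) (t : VectorTerm k r m n) :
    (VectorTerm.smul s t).eval A a x = s.eval A a x • t.eval A a x := by
  simp [VectorTerm.eval, VectorTerm.evalLift, ScalarTerm.eval]

@[simp]
theorem ScalarTerm.eval_sum {s : ℕ} (f : Fin s → ScalarTerm k r m n) :
    (ScalarTerm.sum f).eval A a x = ∑ i, (f i).eval A a x := by
  induction s with
  | zero => simp [ScalarTerm.sum]
  | succ s ih => simp [ScalarTerm.sum, ih, Fin.sum_univ_castSucc]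

@[simp]
theorem VectorTerm.eval_sum {s : ℕ} (f : Fin s → VectorTerm k r m n) :
    (VectorTerm.sum f).eval A a x = ∑ i, (f i).eval A a x := by
  induction s with
  | zero => simp [VectorTerm.sum]
  | succ s ih => simp [VectorTerm.sum, ih, Fin.sum_univ_castSucc]

@[simp]
theorem Formula.realize_neg (φ : Formula k r m n) : φ.neg.Realize A a x ↔ ¬ φ.Realize A a x :=
  Iff.rfl

theorem Formula.realize_allVectors (φ : Formula k r m n) :
    φ.allVectors.Realize A a Fin.elim0 ↔ ∀ x : Fin n → V, φ.Realize A a x := by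
  induction n with
  | zero => exact ⟨fun h x ↦ Subsingleton.elim Fin.elim0 x ▸ h, fun h ↦ h _⟩
  | succ n ih =>
    rw [Formula.allVectors, ih]
    exact ⟨fun h x ↦ Fin.snoc_init_self x ▸ h (Fin.init x) (x (Fin.last n)), fun h x y ↦ h _⟩

theorem Formula.realize_allScalars (φ : Formula k r m n) :
    φ.allScalars.Realize A Fin.elim0 x ↔ ∀ a : Fin m → k, φ.Realize A a x := by
  induction m with
  | zero => exact ⟨fun h a ↦ Subsingleton.elim Fin.elim0 a ▸ h, fun h ↦ h _⟩
  | succ m ih =>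
    rw [Formula.allScalars, ih]
    exact ⟨fun h a ↦ Fin.snoc_init_self a ▸ h (Fin.init a) (a (Fin.last m)), fun h a c ↦ h _⟩

/-- The sentence expressing that `α` is a relation among the forms. -/
def relationSentence (α : Fin r → k) : Sentence k r :=
  Formula.allVectors (n := 2)
    (.eqScalar (.sum fun i ↦ .mul (.const (α i)) (.form i (.var 0) (.var 1))) (.const 0))

/-- The sentences expressing that a tuple of the forms is jointly nondegenerate. -/
def nondegenerateSentence {s : ℕ} (a : Fin s → Fin r) (j : Fin s) : Sentence k r :=
  Formula.allVectors (n := s)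
    (.imp (.allVector (.eqScalar
      (.sum fun i ↦ .form (a i) (.var i.castSucc) (.var (Fin.last s))) (.const 0)))
      (.eqVector (.var j) .zero))

/-- The sentence expressing that no `n` vectors span the space. -/
def notSpannedSentence (k : Type u) (r n : ℕ) : Sentence k r :=
  -- The innermost part says that a vector is outside the span; the two outer negations turn the
  -- quantifier over that vector into an existential one.
  Formula.allVectors (n := n) (.neg (.allVector (.neg (.allScalars (m := n) (.neg
    (.eqVector (.sum fun i ↦ .smul (.var i) (.var i.castSucc)) (.var (Fin.last n))))))))

theorem relationSentence_mem_theory {α : Fin r → k} :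
    relationSentence α ∈ A.theory ↔ α ∈ A.relations := by
  refine (Formula.realize_allVectors A _ _).trans ?_
  simp only [Formula.Realize, ScalarTerm.eval_sum, ScalarTerm.eval_mul, ScalarTerm.eval_const,
    ScalarTerm.eval_form, VectorTerm.eval_var]
  constructor
  · intro h
    change ∑ i, α i • A.form i = 0
    ext x y
    simpa using h ![x, y]
  · intro h x
    have h' : ∑ i, α i • A.form i = 0 := h
    simpa using congr($h' (x 0) (x 1))

theorem forall_nondegenerateSentence_mem_theory {s : ℕ} {a : Fin s → Fin r} :
    (∀ j, nondegenerateSentence a j ∈ A.theory) ↔ JointlyNondegenerate (A.form ∘ a) := by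
  have h (j : Fin s) : nondegenerateSentence a j ∈ A.theory ↔
      ∀ x : Fin s → V, (∀ y, ∑ i, A.form (a i) (x i) y = 0) → x j = 0 := by
    refine (Formula.realize_allVectors A _ _).trans ?_
    simp [Formula.Realize]
  simp only [h]
  exact ⟨fun h x hx ↦ funext fun j ↦ h j x hx, fun h j x hx ↦ congr_fun (h x hx) j⟩

theorem forall_notSpannedSentence_mem_theory :
    (∀ n, notSpannedSentence k r n ∈ A.theory) ↔ ¬ FiniteDimensional k V := by
  have h (n : ℕ) : notSpannedSentence k r n ∈ A.theory ↔
      ∀ x : Fin n → V, Submodule.span k (Set.range x) ≠ ⊤ := by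
    refine (Formula.realize_allVectors A _ _).trans (forall_congr' fun x ↦ ?_)
    rw [Formula.realize_neg, not_iff_not, Submodule.eq_top_iff']
    refine forall_congr' fun y ↦ ?_
    rw [Formula.realize_neg, Formula.realize_allScalars, Submodule.mem_span_range_iff_exists_fun]
    simp [Formula.Realize]
  simp only [h]
  constructor
  · intro h hfin
    exact h _ _ (Module.finBasis k V).span_eq
  · intro h n x hx
    exact h (Module.Finite.of_fg_top ⟨(Set.finite_range x).toFinset, by simpa using hx⟩)

end Sentences

end MultiQuadratic

-- Transfer along equal relation spaces

namespace MultiQuadratic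

section Relations

variable {k : Type u} [Field k] {r : ℕ} {V : Type v} [AddCommGroup V] [Module k V]
  {W : Type w} [AddCommGroup W] [Module k W] {A : MultiQuadratic k r V} {B : MultiQuadratic k r W}

theorem relations_eq_ker (A : MultiQuadratic k r V) :
    A.relations = LinearMap.ker (Fintype.linearCombination k A.form) :=
  rfl

theorem sum_form_eq_zero_of_relations_eq (h : A.relations = B.relations) {κ : Type*} [Fintype κ]
    {a : κ → Fin r} {c : κ → k} (hc : ∑ i, c i • A.form (a i) = 0) :
    ∑ i, c i • B.form (a i) = 0 := by
  have h1 : ∑ i, c i • Pi.single (a i) (1 : k) ∈ A.relations := by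
    rw [relations_eq_ker, LinearMap.mem_ker, map_sum]
    simpa using hc
  rw [h, relations_eq_ker, LinearMap.mem_ker, map_sum] at h1
  simpa using h1

theorem linearIndependent_form_of_relations_eq (h : A.relations = B.relations) {κ : Type*}
    [Fintype κ] {a : κ → Fin r} (ha : LinearIndependent k (A.form ∘ a)) :
    LinearIndependent k (B.form ∘ a) := by
  rw [linearIndependent_iff_injective_fintypeLinearCombination, injective_iff_map_eq_zero] at ha ⊢
  exact fun c hc ↦ ha c (sum_form_eq_zero_of_relations_eq h.symm hc)

theorem form_eq_sum_of_relations_eq (h : A.relations = B.relations) {κ : Type*} [Fintype κ]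
    {a : κ → Fin r} {c : κ → k} {j : Fin r} (hc : ∑ i, c i • A.form (a i) = A.form j) :
    ∑ i, c i • B.form (a i) = B.form j := by
  -- The extra index `none` carries `form j` with coefficient -1, turning the expression into a
  -- relation.
  have := sum_form_eq_zero_of_relations_eq h (κ := Option κ)
    (a := fun o ↦ o.elim j a) (c := fun o ↦ o.elim (-1) c) (by
      rw [Fintype.sum_option]
      simp only [Option.elim_none, Option.elim_some, hc]
      ext x y
      simp)
  rw [Fintype.sum_option] at this
  ext x y
  have hxy := congr($this x y)
  simp only [Option.elim_none, Option.elim_some, LinearMap.add_apply, LinearMap.smul_apply,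
    LinearMap.zero_apply, neg_smul, one_smul] at hxy
  exact (neg_add_eq_zero.1 hxy).symm

theorem Isomorphic.relations_eq (h : A.Isomorphic B) : A.relations = B.relations := by
  obtain ⟨e⟩ := h
  ext α
  change ∑ i, α i • A.form i = 0 ↔ ∑ i, α i • B.form i = 0
  constructor <;> intro h <;> ext x y
  · have := congr($h (e.toLinearEquiv.symm x) (e.toLinearEquiv.symm y))
    simpa [← e.map_form] using this
  · have := congr($h (e.toLinearEquiv x) (e.toLinearEquiv y))
    simpa [e.map_form] using this

/-- The forms are spanned by a linearly independent subtuple. -/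
theorem exists_linearIndependent_form (A : MultiQuadratic k r V) :
    ∃ (s : ℕ) (a : Fin s → Fin r), LinearIndependent k (A.form ∘ a) ∧
      ∀ j, ∃ c : Fin s → k, ∑ i, c i • A.form (a i) = A.form j := by
  obtain ⟨κ, a, ha, hspan, hli⟩ := exists_linearIndependent' k A.form
  have := Finite.of_injective a ha
  obtain ⟨s, ⟨e⟩⟩ := Finite.exists_equiv_fin κ
  refine ⟨s, a ∘ e.symm, hli.comp e.symm e.symm.injective, fun j ↦ ?_⟩
  have hj : A.form j ∈ Submodule.span k (Set.range (A.form ∘ (a ∘ e.symm))) := by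
    rw [← Function.comp_assoc, e.symm.surjective.range_comp, hspan]
    exact Submodule.subset_span ⟨j, rfl⟩
  exact (Submodule.mem_span_range_iff_exists_fun k).1 hj

/-- Partial isometries for a spanning subtuple of the forms extend to isomorphisms. -/
theorem exists_iso_extending [IsAlgClosed k] (h2 : (2 : k) ≠ 0) (hAB : A.relations = B.relations)
    (hV : Module.rank k V = Cardinal.aleph0) (hW : Module.rank k W = Cardinal.aleph0)
    {s : ℕ} {a : Fin s → Fin r} (ha : ∀ j, ∃ c : Fin s → k, ∑ i, c i • A.form (a i) = A.form j)
    (hA : JointlyNondegenerate (A.form ∘ a)) (hB : JointlyNondegenerate (B.form ∘ a))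
    {Γ : Submodule k (V × W)} [FiniteDimensional k Γ]
    (hΓ : IsPartialIsometry (A.form ∘ a) (B.form ∘ a) Γ) :
    ∃ e : A.Iso B, ∀ p ∈ Γ, e.toLinearEquiv p.1 = p.2 := by
  obtain ⟨e, he, heΓ⟩ := hΓ.exists_linearEquiv h2 (fun i ↦ A.symm (a i)) (fun i ↦ B.symm (a i))
    hA hB hV hW
  refine ⟨⟨e, fun j x y ↦ ?_⟩, heΓ⟩
  obtain ⟨c, hc⟩ := ha j
  have he' (i) : B.form (a i) (e x) (e y) = A.form (a i) x y := he i x y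
  rw [← hc, ← form_eq_sum_of_relations_eq hAB hc]
  simp [he']

end Relations

-- A universal finite dimensional subspace

section Oligomorphic

variable {k : Type u} [Field k] {V : Type v} [AddCommGroup V] [Module k V] {ι : Type*} [Fintype ι]
  {ω : ι → LinearMap.BilinForm k V}

/-- A jointly nondegenerate space of infinite dimension has a finite dimensional subspace that
realises every Gram matrix of size `d`. -/
theorem JointlyNondegenerate.exists_universal_subspace [IsAlgClosed k]
    (hω : JointlyNondegenerate ω) (h2 : (2 : k) ≠ 0) (hsymm : ∀ i x y, ω i x y = ω i y x)
    (hV : ¬ FiniteDimensional k V) (d : ℕ) :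
    ∃ E : Submodule k V, FiniteDimensional k E ∧ ∀ M : ι → Fin d → Fin d → k,
      (∀ i a b, M i a b = M i b a) → ∃ x : Fin d → V, LinearIndependent k x ∧ (∀ a, x a ∈ E) ∧
        ∀ i a b, ω i (x a) (x b) = M i a b := by
  classical
  -- The first block is isotropic for all forms; the vector indexed by `(i, a)` pairs only with the
  -- `a`-th of the first block, and only under form `i`. Adding halves of the entries of `M` along
  -- these dual vectors gives `M i b a / 2 + M i a b / 2`.
  let G : ι → (Fin d ⊕ ι × Fin d) → (Fin d ⊕ ι × Fin d) → k := fun i p q ↦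
    match p, q with
    | .inl a, .inr q => if q = (i, a) then 1 else 0
    | .inr q, .inl a => if q = (i, a) then 1 else 0
    | _, _ => 0
  have hG (i p q) : G i p q = G i q p := by
    rcases p with p | p <;> rcases q with q | q <;> rfl
  let e := Fintype.equivFin (Fin d ⊕ ι × Fin d)
  obtain ⟨z, hz, hzG⟩ := hω.exists_gram h2 hsymm hV (fun i a b ↦ G i (e.symm a) (e.symm b))
    (fun i a b ↦ hG i _ _)
  let y : (Fin d ⊕ ι × Fin d) → V := z ∘ e
  have hy : LinearIndependent k y := hz.comp e e.injective
  have hyG (i p q) : ω i (y p) (y q) = G i p q := by simp [y, hzG]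
  have hmem (p) : y p ∈ Submodule.span k (Set.range y) := Submodule.subset_span ⟨p, rfl⟩
  refine ⟨Submodule.span k (Set.range y), FiniteDimensional.span_of_finite k (Set.finite_range y),
    fun M hM ↦ ⟨fun b ↦ y (.inl b) + ∑ q : ι × Fin d, (M q.1 q.2 b / 2) • y (.inr q), ?_,
      fun b ↦ add_mem (hmem _) (Submodule.sum_mem _ fun q _ ↦ Submodule.smul_mem _ _ (hmem _)),
      fun i a b ↦ ?_⟩⟩
  · rw [Fintype.linearIndependent_iff]
    intro g hg b
    -- The corrections lie in the second block, so the first-block coefficients of a relation are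
    -- `g` itself.
    refine Fintype.linearIndependent_iff.1 hy
      (Sum.elim g fun q ↦ ∑ b, g b * (M q.1 q.2 b / 2)) ?_ (.inl b)
    rw [← hg, Fintype.sum_sum_type]
    simp only [Sum.elim_inl, Sum.elim_inr, smul_add, Finset.sum_add_distrib, Finset.smul_sum,
      Finset.sum_smul, smul_smul]
    rw [Finset.sum_comm]
  · simp only [map_add, map_sum, map_smul, LinearMap.add_apply, LinearMap.sum_apply,
      LinearMap.smul_apply, hyG, G, smul_eq_mul, mul_ite, mul_one, mul_zero, Finset.sum_ite_eq',
      Finset.mem_univ, if_true, Finset.sum_const_zero, add_zero, zero_add]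
    rw [hM i b a, ← add_div, ← two_mul, mul_div_cancel_left₀ _ h2]

end Oligomorphic

-- The three assertions

section Main

variable {k : Type u} [Field k] [IsAlgClosed k] [Uncountable k] {r : ℕ}
  {V : Type v} [AddCommGroup V] [Module k V] {W : Type w} [AddCommGroup W] [Module k W]
  {A : MultiQuadratic k r V}

theorem IsIrreducible.isomorphic_of_relations_eq (hA : A.IsIrreducible) (h2 : (2 : k) ≠ 0)
    {B : MultiQuadratic k r W} (hB : B.IsIrreducible) (hV : Module.rank k V = Cardinal.aleph0)
    (hW : Module.rank k W = Cardinal.aleph0) (h : A.relations = B.relations) :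
    A.Isomorphic B := by
  obtain ⟨s, a, hli, hspan⟩ := A.exists_linearIndependent_form
  obtain ⟨e, -⟩ := exists_iso_extending h2 h hV hW hspan (hA.jointlyNondegenerate hV.le hli)
    (hB.jointlyNondegenerate hW.le (linearIndependent_form_of_relations_eq h hli)) .bot
  exact ⟨e⟩

/-- Irreducibility of `B` is not available, but joint nondegeneracy passes to `B` through the theory
and is all that back and forth needs. -/
theorem IsIrreducible.linearlyOmegaCategorical (hA : A.IsIrreducible) (h2 : (2 : k) ≠ 0)
    (hV : Module.rank k V = Cardinal.aleph0) : LinearlyOmegaCategorical.{u, v, w} A := by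
  intro W _ _ B hW hAB
  obtain ⟨s, a, hli, hspan⟩ := A.exists_linearIndependent_form
  have hrel : A.relations = B.relations := by
    ext α
    rw [← relationSentence_mem_theory, ← relationSentence_mem_theory, hAB]
  have hnd := hA.jointlyNondegenerate hV.le hli
  have hV' : ¬ FiniteDimensional k V := fun hf ↦ (Module.rank_lt_aleph0_iff.2 hf).ne hV
  have hW' : ¬ FiniteDimensional k W := by
    rw [← forall_notSpannedSentence_mem_theory B, ← hAB]
    exact (forall_notSpannedSentence_mem_theory A).2 hV'
  have hnd' : JointlyNondegenerate (B.form ∘ a) := by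
    rw [← forall_nondegenerateSentence_mem_theory B, ← hAB]
    exact (forall_nondegenerateSentence_mem_theory A).2 hnd
  obtain ⟨e, -⟩ := exists_iso_extending h2 hrel hV
    (hW.antisymm (not_lt.1 (mt Module.rank_lt_aleph0_iff.1 hW'))) hspan hnd hnd' .bot
  exact ⟨e⟩

theorem IsIrreducible.linearlyOligomorphic (hA : A.IsIrreducible) (h2 : (2 : k) ≠ 0)
    (hV : Module.rank k V ≤ Cardinal.aleph0) : A.autRep.LinearlyOligomorphic := by
  intro d
  by_cases hfin : FiniteDimensional k V
  · exact ⟨⊤, inferInstance, fun W _ _ ↦ ⟨1, le_top⟩⟩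
  have hV' := hV.antisymm (not_lt.1 (mt Module.rank_lt_aleph0_iff.1 hfin))
  obtain ⟨s, a, hli, hspan⟩ := A.exists_linearIndependent_form
  have hnd := hA.jointlyNondegenerate hV hli
  obtain ⟨E, hE, hEM⟩ :=
    hnd.exists_universal_subspace h2 (fun i ↦ A.symm (a i)) hfin d
  refine ⟨E, hE, fun W _ hWd ↦ ?_⟩
  let b := Module.finBasisOfFinrankEq k W hWd
  have hb : LinearIndependent k (fun i ↦ (b i : V)) :=
    b.linearIndependent.map' W.subtype W.ker_subtype
  obtain ⟨x, hx, hxE, hxb⟩ := hEM (fun i p q ↦ A.form (a i) (b p) (b q))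
    (fun i p q ↦ A.symm _ _ _)
  have hfinΓ : FiniteDimensional k (Submodule.span k (Set.range fun i ↦ ((b i : V), x i))) :=
    FiniteDimensional.span_of_finite k (Set.finite_range _)
  -- Source and target are both `A`, so the isometry from `W` onto its copy in `E` extends to an
  -- automorphism.
  obtain ⟨e, he⟩ := exists_iso_extending h2 rfl hV' hV' hspan hnd hnd
    (IsPartialIsometry.span_range hb hx fun i p q ↦ (hxb i p q).symm)
  refine ⟨⟨e.toLinearEquiv, e.map_form⟩, ?_⟩
  have hW : W = Submodule.span k (Set.range fun i ↦ (b i : V)) := by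
    have := congrArg (Submodule.map W.subtype) b.span_eq
    rw [Submodule.map_span, Submodule.map_top, Submodule.range_subtype, ← Set.range_comp] at this
    exact this.symm
  rw [hW, Submodule.map_span, Submodule.span_le]
  rintro _ ⟨_, ⟨i, rfl⟩, rfl⟩
  have : e.toLinearEquiv (b i : V) = x i := he _ (Submodule.subset_span ⟨i, rfl⟩)
  exact (congrArg (· ∈ E) this).mpr (hxE i)

end Main

end MultiQuadratic

theorem mainTheorem5 {k : Type u} [Field k] [IsAlgClosed k] [Uncountable k]
    (hchar : ringChar k ≠ 2) (r : ℕ) :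
    (∀ (V : Type v) [AddCommGroup V] [Module k V] (V' : Type w) [AddCommGroup V'] [Module k V']
        (A : MultiQuadratic k r V) (A' : MultiQuadratic k r V'),
        Module.rank k V = Cardinal.aleph0 → Module.rank k V' = Cardinal.aleph0 →
        A.IsIrreducible → A'.IsIrreducible →
        (A.Isomorphic A' ↔ A.relations = A'.relations)) ∧
    (∀ (V : Type v) [AddCommGroup V] [Module k V] (A : MultiQuadratic k r V),
        Module.rank k V = Cardinal.aleph0 → A.IsIrreducible →
        MultiQuadratic.LinearlyOmegaCategorical.{u, v, w} A) ∧
    (∀ (V : Type v) [AddCommGroup V] [Module k V] (A : MultiQuadratic k r V),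
        Module.rank k V ≤ Cardinal.aleph0 → A.IsIrreducible →
        Function.Injective A.autRep ∧ A.autRep.LinearlyOligomorphic) := by
  have h2 : (2 : k) ≠ 0 := Ring.two_ne_zero hchar
  refine ⟨fun V _ _ V' _ _ A A' hV hV' hA hA' ↦
    ⟨fun h ↦ h.relations_eq, hA.isomorphic_of_relations_eq h2 hA' hV hV'⟩,
    fun V _ _ A hV hA ↦ hA.linearlyOmegaCategorical h2 hV,
    fun V _ _ A hV hA ↦ ⟨fun g h hgh ↦ ?_, hA.linearlyOligomorphic h2 hV⟩⟩
  exact Subtype.ext (LinearEquiv.toLinearMap_injective hgh)
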